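/- **Theorem.** For a finite sequence $x=x_1\dots x_m$ with entries in a linearly ordered set put $\mathrm{Des}(x)=\{i : 1\le i<m,\ x_i>x_{i+1}\}$, $\mathrm{des}(x)=|\mathrm{Des}(x)|$ and $\mathrm{maj}(x)=\sum_{i\in \mathrm{Des}(x)} i$; for a permutation $\sigma$ of $\{1,\dots,n\}$, $\mathrm{maj}(\sigma)$ is $\mathrm{maj}$ of the sequence $\sigma(1)\dots\sigma(n)$. Let $CW_n$ be the set of Catalan words of length $2n$, that is, of words $x_1\dots x_{2n}$ with $x_i\in\{0,1\}$ that contain exactly $n$ letters $1$ and in which no initial segment has more $1$s than $0$s. For a 01-word $w$ let $w^{-1}$ be the word obtained by reversing $w$ and exchanging $0$ and $1$. Let $S_n(123)$ be the set of permutations of $\{1,\dots,n\}$ without an increasing subsequence of length $3$. Then for every $n\ge 0$, as Laurent polynomials in $q$ with integer coefficients, $$\sum_{w\in CW_n} q^{\mathrm{maj}(w)-\mathrm{maj}(w^{-1})}=\sum_{\sigma\in S_n(123)} q^{2(\mathrm{maj}(\sigma)-\mathrm{maj}(\sigma^{-1}))},$$ and (in the form conjectured by Song) $$\sum_{w\in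 CW_n} q^{\mathrm{maj}(w)-n\,\mathrm{des}(w)}=\sum_{\sigma\in S_n(123)} q^{\mathrm{maj}(\sigma)-\mathrm{maj}(\sigma^{-1})}.$$ -/

import Mathlib

/-- The descent set of a finite sequence `x_1 … x_m` with entries in a linear order: the set of
the positions `i` (indexed from `1` to `m - 1`) with `x_i > x_{i+1}`. For a 01-word the descents
are the `i` with `x_i = 1`, `x_{i+1} = 0`; for a permutation take its one-line notation. -/
def descentSet {α : Type*} [LinearOrder α] {m : ℕ} (x : Fin m → α) : Finset ℕ :=
  (Finset.range m).filter fun i =>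
    ∃ (h₁ : i - 1 < m) (h₂ : i < m), 1 ≤ i ∧ x ⟨i, h₂⟩ < x ⟨i - 1, h₁⟩

/-- The number of descents. -/
def descentNumber {α : Type*} [LinearOrder α] {m : ℕ} (x : Fin m → α) : ℕ :=
  (descentSet x).card

/-- The major index: the sum of the (1-indexed) descent positions. -/
def majorIndex {α : Type*} [LinearOrder α] {m : ℕ} (x : Fin m → α) : ℕ :=
  ∑ i ∈ descentSet x, i

/-- A 01-word of length `2 * n` is a Catalan word if it has exactly `n` letters `1` and no initial
segment has more `1`s than `0`s. -/
def IsCatalanWord {n : ℕ} (w : Fin (2 * n) → Fin 2) : Prop :=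
  (Finset.univ.filter fun i => w i = 1).card = n ∧
    ∀ l ≤ 2 * n, (Finset.univ.filter fun i => i.val < l ∧ w i = 1).card ≤
      (Finset.univ.filter fun i => i.val < l ∧ w i = 0).card

instance {n : ℕ} (w : Fin (2 * n) → Fin 2) : Decidable (IsCatalanWord w) := by
  unfold IsCatalanWord; infer_instance

/-- The set `CW_n` of Catalan words of length `2 * n`. -/
def catalanWords (n : ℕ) : Finset (Fin (2 * n) → Fin 2) :=
  Finset.univ.filter fun w => IsCatalanWord w

/-- The inverse of a 01-word: reverse it and exchange `0` and `1`. -/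
def wordInverse {m : ℕ} (w : Fin m → Fin 2) : Fin m → Fin 2 :=
  fun i => 1 - w i.rev

/-- A permutation avoids `123` if it has no increasing subsequence of length `3`. -/
def Avoids123 {n : ℕ} (σ : Equiv.Perm (Fin n)) : Prop :=
  ∀ i j k : Fin n, i < j → j < k → ¬ (σ i < σ j ∧ σ j < σ k)

instance {n : ℕ} (σ : Equiv.Perm (Fin n)) : Decidable (Avoids123 σ) := by
  unfold Avoids123; infer_instance

/-- The set `S_n(123)` of 123-avoiding permutations of `n` letters. -/
def avoiding123 (n : ℕ) : Finset (Equiv.Perm (Fin n)) :=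
  Finset.univ.filter fun σ => Avoids123 σ

/-! Both exponents are weighted sums over a pair of subsets of `range (n - 1)`, with the same
weights `i + 1 - n` on the first set and `j + 1` on the second. For a Catalan word the two sets are
the peaks in the left half and the peaks in the right half (`majorIndex_sub_eq_sum_halves`). For `σ`
they are the descent sets of the reversal `τ` of `σ` and of `τ⁻¹` (`majorIndex_sub_majorIndex_inv`).
Since `T` of such a sum is a product of factors `1 + [i in the set] (T(weight) - 1)`, it suffices
that for all `A`, `B` equally many words and permutations have pairs of sets containing `A` and `B`
(`sum_T_eq_sum_powerset`).

A 321-avoiding `τ` is determined by its weak excedance positions and values. Interleaving these two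
sets gives a bijection onto Catalan words, under which descents of `τ` and `τ⁻¹` become patterns `0
x 1` starting at even and odd places respectively (`card_avoiding123_descents`). It remains to
compare prescribed peaks `01` with prescribed patterns `0 x 1` (`card_catalanWords_peaks`). Either
kind of constraint is contradictory if `A` or `B` contains two consecutive numbers; otherwise
deleting the prescribed letters leaves an arbitrary Catalan word shorter by `2 * (|A| + |B|)`.

The first identity is the second with `q` replaced by `q ^ 2`, because `maj(w⁻¹) = 2n des(w) -
maj(w)`. -/

/-! ### Ballot paths with prescribed letters -/

/-- The 01-word `w` read as a lattice path (`0` up, `1` down) that starts at height `h`, never goes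
below `0` and ends at height `0`. -/
def IsBallotFrom : (m : ℕ) → ℕ → (Fin m → Fin 2) → Prop
  | 0, h, _ => h = 0
  | m + 1, h, w => (w 0 = 0 ∧ IsBallotFrom m (h + 1) (Fin.tail w)) ∨
      (w 0 = 1 ∧ 1 ≤ h ∧ IsBallotFrom m (h - 1) (Fin.tail w))

open Classical in
/-- The number of ballot paths of length `m` from height `h` whose letter at each position `p`
is allowed by `c p`. -/
noncomputable def ballotCount : ℕ → ℕ → (ℕ → Fin 2 → Prop) → ℕ
  | 0, h, _ => if h = 0 then 1 else 0
  | m + 1, h, c => (if c 0 0 then ballotCount m (h + 1) (fun p => c (p + 1)) else 0) +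
      (if c 0 1 ∧ 1 ≤ h then ballotCount m (h - 1) (fun p => c (p + 1)) else 0)

open Classical in
theorem card_isBallotFrom (m h : ℕ) (c : ℕ → Fin 2 → Prop) :
    (Finset.univ.filter fun w : Fin m → Fin 2 =>
      IsBallotFrom m h w ∧ ∀ i : Fin m, c i (w i)).card = ballotCount m h c := by
  induction m generalizing h c with
  | zero => by_cases hh : h = 0 <;> simp [IsBallotFrom, ballotCount, hh]
  | succ m ih =>
    rw [Finset.card_filter, ← (Fin.consEquiv (fun _ : Fin (m + 1) => Fin 2)).sum_comp,
      Fintype.sum_prod_type, Fin.sum_univ_two, ballotCount]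
    simp only [Fin.consEquiv_apply, Fin.forall_fin_succ, Fin.cons_zero, Fin.cons_succ,
      IsBallotFrom, Fin.val_zero, Fin.val_succ]
    congr 1
    · split_ifs with h0
      · rw [← ih, Finset.card_filter]
        simp [h0]
        rfl
      · simp [h0]
    · split_ifs with h0
      · rw [← ih, Finset.card_filter]
        simp [h0]
        rfl
      · refine Finset.sum_eq_zero fun w _ => if_neg ?_
        rintro ⟨h1 | h1, h2⟩
        · exact absurd h1.1 (by decide)
        · exact h0 ⟨h2.1, h1.2.1⟩

/-- Letter `a` is allowed at `p` if each `q` with `s q` carries a `0` at `q` and a `1` at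
`q + δ`. -/
def forcedLetter (δ : ℕ) (s : ℕ → Prop) (p : ℕ) (a : Fin 2) : Prop :=
  (s p → a = 0) ∧ ∀ q, q + δ = p → s q → a = 1

theorem forcedLetter_succ {δ : ℕ} {s : ℕ → Prop} (h0 : ¬ s 0) :
    (fun p => forcedLetter δ s (p + 1)) = forcedLetter δ (fun p => s (p + 1)) := by
  funext p a
  refine propext (and_congr Iff.rfl ⟨fun h q hq => h (q + 1) (by omega), fun h q hq hs => ?_⟩)
  obtain _ | q := q
  · exact absurd hs h0
  · exact h q (by omega) hs

theorem ballotCount_free (m h : ℕ) :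
    ballotCount (m + 1) h (fun _ _ => True) = ballotCount m (h + 1) (fun _ _ => True) +
      if 1 ≤ h then ballotCount m (h - 1) (fun _ _ => True) else 0 := by
  simp [ballotCount]

theorem ballotCount_push {m h : ℕ} {c : ℕ → Fin 2 → Prop} (h0 : c 0 0) (h1 : ¬ c 0 1) :
    ballotCount (m + 1) h c = ballotCount m (h + 1) (fun p => c (p + 1)) := by
  simp [ballotCount, h0, h1]

theorem ballotCount_pop {m h : ℕ} {c : ℕ → Fin 2 → Prop} (h0 : ¬ c 0 0) (h1 : c 0 1) :
    ballotCount (m + 1) (h + 1) c = ballotCount m h (fun p => c (p + 1)) := by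
  simp [ballotCount, h0, h1]

theorem ballotCount_any {m h : ℕ} {c : ℕ → Fin 2 → Prop} (h0 : c 0 0) (h1 : c 0 1) :
    ballotCount (m + 1) h c = ballotCount m (h + 1) (fun p => c (p + 1)) +
      if 1 ≤ h then ballotCount m (h - 1) (fun p => c (p + 1)) else 0 := by
  simp [ballotCount, h0, h1]

open Classical in
/-- Prescribing peaks at `k` positions, no two adjacent, amounts to shortening the path by
`2 * k`. -/
theorem ballotCount_forced_one (m h : ℕ) (s : ℕ → Prop) (hm : ∀ p, s p → p + 1 < m)
    (hs : ∀ p, s p → ¬ s (p + 1)) :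
    2 * Nat.count s m ≤ m ∧ ballotCount m h (forcedLetter 1 s) =
      ballotCount (m - 2 * Nat.count s m) h (fun _ _ => True) := by
  induction m using Nat.strong_induction_on generalizing h s with
  | _ m ih =>
  obtain _ | m := m
  · simp [ballotCount]
  by_cases h0 : s 0
  · obtain _ | m := m
    · exact absurd (hm 0 h0) (by omega)
    have h1 := hs 0 h0
    have IH := ih m (by omega) h (fun p => s (p + 1 + 1)) (fun p hp => by have := hm _ hp; omega)
      (fun p hp => hs _ hp)
    rw [Nat.count_succ', Nat.count_succ']
    simp only [h0, h1, if_true, if_false, zero_add]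
    refine ⟨by omega, ?_⟩
    rw [ballotCount_push (by simp [forcedLetter, h0]) (by simp [forcedLetter, h0]),
      ballotCount_pop (by simp [forcedLetter, h0]) (by simp [forcedLetter, h1])]
    have : (fun p => forcedLetter 1 s (p + 1 + 1)) = forcedLetter 1 (fun p => s (p + 1 + 1)) := by
      funext p a
      refine propext (and_congr Iff.rfl
        ⟨fun h q hq => h (q + 2) (by omega), fun h q hq hs => ?_⟩)
      obtain _ | _ | q := q
      · omega
      · exact absurd hs h1
      · exact h q (by omega) hs
    rw [this, IH.2]
    congr 1
    omega
  · have IH := fun h => ih m (by omega) h (fun p => s (p + 1))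
      (fun p hp => by have := hm _ hp; omega) (fun p hp => hs _ hp)
    rw [Nat.count_succ']
    simp only [h0, if_false, add_zero]
    have h2 := (IH 0).1
    refine ⟨by omega, ?_⟩
    rw [ballotCount_any (by simp [forcedLetter]) (by simp [forcedLetter, h0]),
      forcedLetter_succ h0, (IH _).2, (IH _).2,
      Nat.sub_add_comm h2, ballotCount_free]

open Classical in
/-- Prescribing `k` pairs of letters `0 … 1` at distance two, no two of them sharing a position,
amounts to shortening the path by `2 * k`. -/
theorem ballotCount_forced_two (m h : ℕ) (s : ℕ → Prop) (hm : ∀ p, s p → p + 2 < m)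
    (hs : ∀ p, s p → ¬ s (p + 2)) :
    2 * Nat.count s m ≤ m ∧ ballotCount m h (forcedLetter 2 s) =
      ballotCount (m - 2 * Nat.count s m) h (fun _ _ => True) := by
  induction m using Nat.strong_induction_on generalizing h s with
  | _ m ih =>
  obtain _ | m := m
  · simp [ballotCount]
  by_cases h0 : s 0
  · obtain _ | _ | m := m
    · exact absurd (hm 0 h0) (by omega)
    · exact absurd (hm 0 h0) (by omega)
    have h2 : ¬ s (1 + 1) := hs 0 h0
    have h2' : ¬ s 2 := hs 0 h0
    -- If both `0` and `1` are marked, the word starts with `0011`, which is deleted as a block: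
    -- treating the pairs one at a time would leave a pending letter `1`.
    by_cases h1 : s 1
    · obtain _ | m := m
      · exact absurd (hm 1 h1) (by omega)
      have h3 : ¬ s (1 + 1 + 1) := hs 1 h1
      have h3' : ¬ s 3 := hs 1 h1
      have IH := ih m (by omega) h (fun p => s (p + 1 + 1 + 1 + 1))
        (fun p hp => by have := hm _ hp; omega) (fun p hp => hs _ hp)
      rw [Nat.count_succ', Nat.count_succ', Nat.count_succ', Nat.count_succ']
      simp only [h0, h1, h2, h3, if_true, if_false, zero_add]
      refine ⟨by omega, ?_⟩
      rw [ballotCount_push (by simp [forcedLetter, h0]) (by simp [forcedLetter, h0]),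
        ballotCount_push (by simp [forcedLetter, h1]) (by simp [forcedLetter, h1]),
        ballotCount_pop (by simp [forcedLetter, h0]) (by simp [forcedLetter, h2']),
        ballotCount_pop (by simp [forcedLetter, h1]) (by simp [forcedLetter, h3'])]
      have : (fun p => forcedLetter 2 s (p + 1 + 1 + 1 + 1)) =
          forcedLetter 2 (fun p => s (p + 1 + 1 + 1 + 1)) := by
        funext p a
        refine propext (and_congr Iff.rfl
          ⟨fun h q hq => h (q + 4) (by omega), fun h q hq hs => ?_⟩)
        obtain _ | _ | _ | _ | q := q
        · omega
        · omega
        · exact absurd hs h2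
        · exact absurd hs h3
        · exact h q (by omega) hs
      rw [this, IH.2]
      congr 1
      omega
    -- The word starts with `0 x 1`, where `x` is free; deleting the two prescribed letters keeps
    -- `x` as the first step of the shorter path.
    · have IH := fun h => ih m (by omega) h (fun p => s (p + 1 + 1 + 1))
        (fun p hp => by have := hm _ hp; omega) (fun p hp => hs _ hp)
      rw [Nat.count_succ', Nat.count_succ', Nat.count_succ']
      simp only [h0, h1, h2, if_true, if_false, zero_add]
      have hc := (IH 0).1
      refine ⟨by omega, ?_⟩
      have : (fun p => forcedLetter 2 s (p + 1 + 1 + 1)) =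
          forcedLetter 2 (fun p => s (p + 1 + 1 + 1)) := by
        funext p a
        refine propext (and_congr Iff.rfl
          ⟨fun h q hq => h (q + 3) (by omega), fun h q hq hs => ?_⟩)
        obtain _ | _ | _ | q := q
        · omega
        · exact absurd hs h1
        · exact absurd hs h2
        · exact h q (by omega) hs
      have hpop : ∀ h, ballotCount (m + 1) (h + 1)
          (fun p => forcedLetter 2 s (p + 1 + 1)) =
          ballotCount m h (fun p => forcedLetter 2 s (p + 1 + 1 + 1)) := fun h =>
        ballotCount_pop (by simp [forcedLetter, h0]) (by simp [forcedLetter, h2'])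
      rw [ballotCount_push (by simp [forcedLetter, h0]) (by simp [forcedLetter, h0]),
        ballotCount_any (by simp [forcedLetter]) (by simp [forcedLetter, h1]),
        if_pos (by omega), Nat.add_sub_cancel, hpop]
      have hlen : m + 1 + 1 + 1 - 2 * (Nat.count (fun k => s (k + 1 + 1 + 1)) m + 1) =
          m - 2 * Nat.count (fun k => s (k + 1 + 1 + 1)) m + 1 := by omega
      rw [hlen, ballotCount_free, this, (IH _).2]
      congr 1
      -- For `x = 1` at height `0` both sides vanish: the prescribed `1` after `01` would go below
      -- `0`, and so would `x` alone in the shortened path.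
      obtain _ | h := h
      · simp [ballotCount, forcedLetter, h0]
      · rw [hpop, this, (IH _).2, if_pos (by omega), Nat.add_sub_cancel]
  · have IH := fun h => ih m (by omega) h (fun p => s (p + 1))
      (fun p hp => by have := hm _ hp; omega) (fun p hp => hs _ hp)
    rw [Nat.count_succ']
    simp only [h0, if_false, add_zero]
    have h2 := (IH 0).1
    refine ⟨by omega, ?_⟩
    rw [ballotCount_any (by simp [forcedLetter]) (by simp [forcedLetter, h0]),
      forcedLetter_succ h0, (IH _).2, (IH _).2,
      Nat.sub_add_comm h2, ballotCount_free]

/-! ### Catalan words as ballot paths, and the comparison of the two patterns -/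

theorem card_prefix_succ {m : ℕ} (w : Fin (m + 1) → Fin 2) (l : ℕ) (a : Fin 2) :
    (Finset.univ.filter fun i => i.val < l + 1 ∧ w i = a).card =
      (Finset.univ.filter fun i => i.val < l ∧ Fin.tail w i = a).card +
        if w 0 = a then 1 else 0 := by
  rw [Fin.card_filter_univ_succ]
  by_cases h : w 0 = a <;> simp [h, Fin.tail] <;> congr!

theorem isBallotFrom_iff {m : ℕ} (h : ℕ) (w : Fin m → Fin 2) :
    IsBallotFrom m h w ↔
      (Finset.univ.filter fun i => i.val < m ∧ w i = 1).card =
        h + (Finset.univ.filter fun i => i.val < m ∧ w i = 0).card ∧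
      ∀ l ≤ m, (Finset.univ.filter fun i => i.val < l ∧ w i = 1).card ≤
        h + (Finset.univ.filter fun i => i.val < l ∧ w i = 0).card := by
  induction m generalizing h with
  | zero => simp [IsBallotFrom, eq_comm]
  | succ m ih =>
    have key : (∀ l ≤ m + 1, (Finset.univ.filter fun i => i.val < l ∧ w i = 1).card ≤
        h + (Finset.univ.filter fun i => i.val < l ∧ w i = 0).card) ↔
        ∀ l ≤ m, (Finset.univ.filter fun i => i.val < l + 1 ∧ w i = 1).card ≤
        h + (Finset.univ.filter fun i => i.val < l + 1 ∧ w i = 0).card := by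
      refine ⟨fun H l hl => H (l + 1) (by omega), fun H l hl => ?_⟩
      obtain _ | l := l
      · simp
      · exact H l (by omega)
    rw [key, IsBallotFrom, ih, ih]
    simp only [card_prefix_succ]
    obtain h0 | h0 : w 0 = 0 ∨ w 0 = 1 := by
      generalize w 0 = a
      revert a
      decide
    · simp only [h0, true_and, zero_ne_one, false_and, or_false, if_true, if_false, add_zero]
      refine and_congr (by omega) (forall₂_congr fun l _ => by omega)
    · simp only [h0, true_and, one_ne_zero, false_and, false_or, if_true, if_false, add_zero]
      refine ⟨fun ⟨h1, h2, h3⟩ => ⟨by omega, fun l hl => by have := h3 l hl; omega⟩,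
        fun ⟨h1, h2⟩ => ⟨?_, by
          have := h2 m le_rfl
          have := h2 0 (Nat.zero_le _)
          simp at this
          omega, fun l hl => by have := h2 l hl; omega⟩⟩
      have := h2 0 (Nat.zero_le _)
      simp at this
      exact this

theorem card_zero_add_card_one {m : ℕ} (w : Fin m → Fin 2) :
    (Finset.univ.filter fun i => w i = 0).card + (Finset.univ.filter fun i => w i = 1).card = m := by
  have h : ∀ i, w i = 1 ↔ ¬ w i = 0 := fun i => by
    generalize w i = a
    revert a
    decide
  simp only [h]
  rw [Finset.card_filter_add_card_filter_not]
  simp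

theorem isCatalanWord_iff {n : ℕ} (w : Fin (2 * n) → Fin 2) :
    IsCatalanWord w ↔ IsBallotFrom (2 * n) 0 w := by
  rw [isBallotFrom_iff, IsCatalanWord]
  have := card_zero_add_card_one w
  simp only [Fin.is_lt, true_and, zero_add]
  exact and_congr (by omega) Iff.rfl

/-- The letter of `w` at position `p`, and `0` beyond the end of `w`. -/
def letterAt {m : ℕ} (w : Fin m → Fin 2) (p : ℕ) : Fin 2 :=
  if h : p < m then w ⟨p, h⟩ else 0

open Classical in
theorem card_isBallotFrom_forced (m h δ : ℕ) (s : ℕ → Prop) (hs : ∀ p, s p → p + δ < m) :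
    (Finset.univ.filter fun w : Fin m → Fin 2 =>
      IsBallotFrom m h w ∧ ∀ p, s p → letterAt w p = 0 ∧ letterAt w (p + δ) = 1).card =
      ballotCount m h (forcedLetter δ s) := by
  rw [← card_isBallotFrom]
  congr 1
  refine Finset.filter_congr fun w _ => and_congr_right fun _ => ⟨fun H i => ⟨fun hi => ?_,
    fun q hq hsq => ?_⟩, fun H p hp => ⟨?_, ?_⟩⟩
  · simpa [letterAt] using (H i hi).1
  · simpa [letterAt, hq] using (H q hsq).2
  · have h1 := hs p hp
    have h2 : p < m := by omega
    simpa [letterAt, h2] using (H ⟨p, h2⟩).1 hp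
  · have h1 := hs p hp
    simpa [letterAt, h1] using (H ⟨p + δ, h1⟩).2 p rfl hp

/-- Peaks at prescribed positions of the two halves of a Catalan word are as frequent as
letters `0`, `1` at prescribed even, respectively odd, positions and two places later. -/
theorem card_catalanWords_peaks (n : ℕ) (A B : Finset ℕ) (hA : A ⊆ Finset.range (n - 1))
    (hB : B ⊆ Finset.range (n - 1)) :
    ((catalanWords n).filter fun w =>
      (∀ i ∈ A, letterAt w i = 0 ∧ letterAt w (i + 1) = 1) ∧
        ∀ j ∈ B, letterAt w (n + j) = 0 ∧ letterAt w (n + j + 1) = 1).card =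
    ((catalanWords n).filter fun w =>
      (∀ i ∈ A, letterAt w (2 * i) = 0 ∧ letterAt w (2 * i + 2) = 1) ∧
        ∀ j ∈ B, letterAt w (2 * j + 1) = 0 ∧ letterAt w (2 * j + 1 + 2) = 1).card := by
  classical
  have hA' : ∀ i ∈ A, i < n - 1 := fun i hi => Finset.mem_range.1 (hA hi)
  have hB' : ∀ i ∈ B, i < n - 1 := fun i hi => Finset.mem_range.1 (hB hi)
  by_cases hsp : (∀ i ∈ A, i + 1 ∉ A) ∧ ∀ j ∈ B, j + 1 ∉ B
  · obtain ⟨s₁, hs₁⟩ : ∃ s : ℕ → Prop, ∀ p, s p ↔ (p ∈ A ∨ ∃ j ∈ B, n + j = p) :=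
      ⟨_, fun _ => Iff.rfl⟩
    obtain ⟨s₂, hs₂⟩ : ∃ s : ℕ → Prop, ∀ p, s p ↔
        ((∃ i ∈ A, 2 * i = p) ∨ ∃ j ∈ B, 2 * j + 1 = p) := ⟨_, fun _ => Iff.rfl⟩
    have hm₁ : ∀ p, s₁ p → p + 1 < 2 * n := by
      simp only [hs₁]
      rintro p (hp | ⟨j, hj, rfl⟩)
      · have := hA' p hp; omega
      · have := hB' j hj; omega
    have hm₂ : ∀ p, s₂ p → p + 2 < 2 * n := by
      simp only [hs₂]
      rintro p (⟨i, hi, rfl⟩ | ⟨j, hj, rfl⟩)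
      · have := hA' i hi; omega
      · have := hB' j hj; omega
    -- The halves do not interact: elements of `A` are at most `n - 2`, so position `n - 1` is never
    -- marked.
    have hd₁ : ∀ p, s₁ p → ¬ s₁ (p + 1) := by
      simp only [hs₁]
      rintro p (hp | ⟨j, hj, rfl⟩) (hq | ⟨k, hk, hq⟩)
      · exact hsp.1 p hp hq
      · have := hA' p hp; omega
      · have := hA' _ hq; omega
      · obtain rfl : k = j + 1 := by omega
        exact hsp.2 j hj hk
    -- Here parity separates `A` from `B`.
    have hd₂ : ∀ p, s₂ p → ¬ s₂ (p + 2) := by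
      simp only [hs₂]
      rintro p (⟨i, hi, rfl⟩ | ⟨j, hj, rfl⟩) (⟨k, hk, hq⟩ | ⟨k, hk, hq⟩)
      · obtain rfl : k = i + 1 := by omega
        exact hsp.1 i hi hk
      · omega
      · omega
      · obtain rfl : k = j + 1 := by omega
        exact hsp.2 j hj hk
    have hc₁ : Nat.count s₁ (2 * n) = A.card + B.card := by
      rw [Nat.count_eq_card_filter_range,
        ← Finset.card_image_of_injective B (add_right_injective n), ← Finset.card_union_of_disjoint]
      · congr 1
        ext p
        simp only [Finset.mem_filter, Finset.mem_range, Finset.mem_union, Finset.mem_image]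
        rw [hs₁]
        exact ⟨fun h => h.2, fun h => ⟨by have := hm₁ p ((hs₁ p).2 h); omega, h⟩⟩
      · rw [Finset.disjoint_left]
        intro p hp hq
        obtain ⟨j, hj, rfl⟩ := Finset.mem_image.1 hq
        have := hA' _ hp
        omega
    have hc₂ : Nat.count s₂ (2 * n) = A.card + B.card := by
      rw [Nat.count_eq_card_filter_range,
        ← Finset.card_image_of_injective A (f := fun i => 2 * i) (fun a b h => by simpa using h),
        ← Finset.card_image_of_injective B (f := fun i => 2 * i + 1)
          (fun a b h => by simpa using h), ← Finset.card_union_of_disjoint]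
      · congr 1
        ext p
        simp only [Finset.mem_filter, Finset.mem_range, Finset.mem_union, Finset.mem_image]
        rw [hs₂]
        exact ⟨fun h => h.2, fun h => ⟨by have := hm₂ p ((hs₂ p).2 h); omega, h⟩⟩
      · rw [Finset.disjoint_left]
        intro p hp hq
        obtain ⟨j, hj, rfl⟩ := Finset.mem_image.1 hq
        obtain ⟨i, hi, hij⟩ := Finset.mem_image.1 hp
        omega
    have e₁ := (card_isBallotFrom_forced (2 * n) 0 1 s₁ hm₁).trans
      (ballotCount_forced_one (2 * n) 0 s₁ hm₁ hd₁).2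
    have e₂ := (card_isBallotFrom_forced (2 * n) 0 2 s₂ hm₂).trans
      (ballotCount_forced_two (2 * n) 0 s₂ hm₂ hd₂).2
    rw [hc₁] at e₁
    rw [hc₂] at e₂
    have e := e₁.trans e₂.symm
    simp only [catalanWords, Finset.filter_filter, isCatalanWord_iff]
    convert e using 4
    · simp only [hs₁, or_imp, forall_and, forall_exists_index, and_imp, forall_apply_eq_imp_iff₂]
      tauto
    · simp only [hs₂, or_imp, forall_and, forall_exists_index, and_imp, forall_apply_eq_imp_iff₂]
      tauto
  -- Two consecutive elements of `A` or of `B` demand both letters at one position, so both counts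
  -- are `0`.
  · have hne : ∀ a : Fin 2, a = 0 → ¬ a = 1 := by decide
    rw [Finset.filter_false_of_mem, Finset.filter_false_of_mem]
    · rintro w - ⟨h1, h2⟩
      refine hsp ⟨fun i hi hj => ?_, fun i hi hj => ?_⟩
      · exact hne _ (h1 _ hj).1 (h1 _ hi).2
      · exact hne _ (h2 _ hj).1 (h2 _ hi).2
    · rintro w - ⟨h1, h2⟩
      refine hsp ⟨fun i hi hj => ?_, fun i hi hj => ?_⟩
      · exact hne _ (h1 _ hj).1 (h1 _ hi).2
      · exact hne _ (h2 _ hj).1 (h2 _ hi).2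

/-! ### Descents and weak excedances of 321-avoiding permutations -/

/-- A permutation avoids `321` if it has no decreasing subsequence of length `3`. -/
def Avoids321 {n : ℕ} (τ : Equiv.Perm (Fin n)) : Prop :=
  ∀ i j k : Fin n, i < j → j < k → ¬ (τ k < τ j ∧ τ j < τ i)

/-- Pigeonhole: otherwise `τ` would map the initial segment below `t` onto itself, leaving no room
for the value `τ a`. It supplies the third entry of every 321 pattern below. -/
theorem exists_lt_le_apply {n : ℕ} (τ : Equiv.Perm (Fin n)) {t : ℕ}
    (h : ∃ a : Fin n, t ≤ (a : ℕ) ∧ (τ a : ℕ) < t) : ∃ b : Fin n, (b : ℕ) < t ∧ t ≤ (τ b : ℕ) := by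
  by_contra! H
  obtain ⟨a, ha, hta⟩ := h
  have hsub : (Finset.univ.filter fun b : Fin n => (b : ℕ) < t).map τ.toEmbedding ⊆
      Finset.univ.filter fun b : Fin n => (b : ℕ) < t := by
    intro x hx
    obtain ⟨b, hb, rfl⟩ := Finset.mem_map.1 hx
    simpa using H b (by simpa using hb)
  have heq := Finset.eq_of_subset_of_card_le hsub (by rw [Finset.card_map])
  have : τ a ∈ (Finset.univ.filter fun b : Fin n => (b : ℕ) < t).map τ.toEmbedding := by
    rw [heq]
    simpa using hta
  obtain ⟨b, hb, hab⟩ := Finset.mem_map.1 this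
  obtain rfl : b = a := τ.injective hab
  simp at hb
  omega

theorem exists_le_apply_lt {n : ℕ} (τ : Equiv.Perm (Fin n)) {t : ℕ}
    (h : ∃ a : Fin n, (a : ℕ) < t ∧ t ≤ (τ a : ℕ)) : ∃ b : Fin n, t ≤ (b : ℕ) ∧ (τ b : ℕ) < t := by
  obtain ⟨a, ha, hta⟩ := h
  obtain ⟨c, hc, htc⟩ := exists_lt_le_apply τ⁻¹ ⟨τ a, hta, by simpa using ha⟩
  exact ⟨τ⁻¹ c, htc, by simpa using hc⟩

namespace Avoids321

variable {n : ℕ} {τ : Equiv.Perm (Fin n)}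

theorem inv (h : Avoids321 τ) : Avoids321 τ⁻¹ := by
  intro i j k hij hjk ⟨h1, h2⟩
  exact h _ _ _ h1 h2 ⟨by simpa using hij, by simpa using hjk⟩

/-- If `τ i ≤ i`, then `j` takes a value below `i`, so some earlier `b` takes a value of at least
`i`, and `b, i, j` form a 321 pattern. The second half is symmetric. -/
theorem lt_apply_of_descent (h : Avoids321 τ) {i j : Fin n} (hij : (j : ℕ) = i + 1)
    (hd : τ j < τ i) : i < τ i ∧ τ j < j := by
  constructor
  · by_contra! hi
    obtain ⟨b, hb, hb'⟩ := exists_lt_le_apply τ (t := i) ⟨j, by omega, by omega⟩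
    have hne : τ b ≠ τ i := fun e => by
      have := τ.injective e
      omega
    exact h b i j (by omega) (by omega) ⟨hd, by omega⟩
  · by_contra! hj
    obtain ⟨b, hb, hb'⟩ := exists_le_apply_lt τ (t := j + 1) ⟨i, by omega, by omega⟩
    have hne : τ b ≠ τ j := fun e => by
      have := τ.injective e
      omega
    exact h i j b (by omega) (by omega) ⟨by omega, hd⟩

theorem descent_iff (h : Avoids321 τ) {i j : Fin n} (hij : (j : ℕ) = i + 1) :
    τ j < τ i ↔ i ≤ τ i ∧ τ j < j := by
  refine ⟨fun hd => ?_, fun ⟨h1, h2⟩ => ?_⟩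
  · have := h.lt_apply_of_descent hij hd
    exact ⟨this.1.le, this.2⟩
  · have hne : τ i ≠ τ j := fun e => by
      have := τ.injective e
      omega
    omega

/-- The placement of strict and weak inequalities is the one needed for `τ⁻¹`: it then speaks of
weak excedance values of `τ`, as `descent_iff` speaks of weak excedance positions. -/
theorem descent_iff' (h : Avoids321 τ) {i j : Fin n} (hij : (j : ℕ) = i + 1) :
    τ j < τ i ↔ i < τ i ∧ τ j ≤ j := by
  refine ⟨fun hd => ?_, fun ⟨h1, h2⟩ => ?_⟩
  · have := h.lt_apply_of_descent hij hd
    exact ⟨this.1, this.2.le⟩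
  · have hne : τ i ≠ τ j := fun e => by
      have := τ.injective e
      omega
    omega

theorem strictMonoOn_excedance (h : Avoids321 τ) : StrictMonoOn τ {a | a ≤ τ a} := by
  intro a (ha : a ≤ τ a) b (hb : b ≤ τ b) hab
  by_contra! H
  have hne : τ a ≠ τ b := fun e => by
    have := τ.injective e
    omega
  obtain ⟨c, hc, hc'⟩ := exists_le_apply_lt τ (t := b + 1) ⟨a, by omega, by omega⟩
  have hne' : τ c ≠ τ b := fun e => by
    have := τ.injective e
    omega
  exact h a b c hab (by omega) ⟨by omega, by omega⟩

theorem strictMonoOn_not_excedance (h : Avoids321 τ) : StrictMonoOn τ {a | ¬ a ≤ τ a} := by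
  intro a (ha : ¬ a ≤ τ a) b (hb : ¬ b ≤ τ b) hab
  by_contra! H
  have hne : τ a ≠ τ b := fun e => by
    have := τ.injective e
    omega
  obtain ⟨c, hc, hc'⟩ := exists_lt_le_apply τ (t := a) ⟨b, by omega, by omega⟩
  exact h c a b (by omega) hab ⟨by omega, by omega⟩

end Avoids321

/-- A function that is strictly increasing on `E` preserves ranks. -/
theorem card_image_filter_lt {n : ℕ} {f : Fin n → Fin n} {E : Finset (Fin n)}
    (hf : StrictMonoOn f E) {a : Fin n} (ha : a ∈ E) :
    ((E.image f).filter (· < f a)).card = (E.filter (· < a)).card := by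
  rw [Finset.filter_image, Finset.card_image_of_injOn]
  · congr 1
    exact Finset.filter_congr fun b hb => hf.lt_iff_lt hb ha
  · exact hf.injOn.mono fun x hx => (Finset.mem_filter.1 hx).1

theorem card_filter_lt_strictMono {n : ℕ} {V : Finset (Fin n)} {a b : Fin n} (ha : a ∈ V)
    (hab : a < b) : (V.filter (· < a)).card < (V.filter (· < b)).card := by
  refine Finset.card_lt_card (Finset.ssubset_iff_of_subset ?_ |>.2 ⟨a, by simp [ha, hab], by simp⟩)
  intro x hx
  simp only [Finset.mem_filter] at hx ⊢
  exact ⟨hx.1, hx.2.trans hab⟩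

/-- Both values have the rank of `a` in `E` within the common image, and distinct elements of a set
have distinct ranks. -/
theorem eqOn_of_strictMonoOn_of_image_eq {n : ℕ} {f g : Fin n → Fin n} {E : Finset (Fin n)}
    (hf : StrictMonoOn f E) (hg : StrictMonoOn g E) (h : E.image f = E.image g) {a : Fin n}
    (ha : a ∈ E) : f a = g a := by
  have h1 := card_image_filter_lt hf ha
  have h2 := card_image_filter_lt hg ha
  rw [← h, ← h1] at h2
  rcases lt_trichotomy (f a) (g a) with hlt | heq | hlt
  · have := card_filter_lt_strictMono (Finset.mem_image_of_mem f ha) hlt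
    omega
  · exact heq
  · have := card_filter_lt_strictMono (V := E.image f)
      (by rw [h]; exact Finset.mem_image_of_mem g ha) hlt
    omega

/-! ### Encoding 321-avoiding permutations by weak excedance positions and values -/

/-- The set of weak excedance positions of a permutation. -/
def excedancePositions {n : ℕ} (τ : Equiv.Perm (Fin n)) : Finset (Fin n) :=
  Finset.univ.filter fun a => a ≤ τ a

/-- The set of weak excedance values of a permutation. -/
def excedanceValues {n : ℕ} (τ : Equiv.Perm (Fin n)) : Finset (Fin n) :=
  Finset.univ.filter fun b => τ⁻¹ b ≤ b

theorem image_excedancePositions {n : ℕ} (τ : Equiv.Perm (Fin n)) :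
    (excedancePositions τ).image τ = excedanceValues τ := by
  ext b
  simp only [excedancePositions, excedanceValues, Finset.mem_image, Finset.mem_filter,
    Finset.mem_univ, true_and]
  exact ⟨by rintro ⟨a, ha, rfl⟩; simpa using ha, fun h => ⟨τ⁻¹ b, by simpa using h, by simp⟩⟩

theorem image_compl_perm {n : ℕ} (τ : Equiv.Perm (Fin n)) (E : Finset (Fin n)) :
    Eᶜ.image τ = (E.image τ)ᶜ := by
  rw [← Finset.coe_inj]
  push_cast
  exact Set.image_compl_eq τ.bijective

/-- The condition on the pair (weak excedance positions, weak excedance values). -/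
def NonCrossing {n : ℕ} (E V : Finset (Fin n)) : Prop :=
  E.card = V.card ∧ ∀ i : Fin n, (V.filter (· < i)).card ≤ (E.filter (· < i)).card ∧
    (i ∉ E → (V.filter (· < i)).card < (E.filter (· < i)).card)

/-- `τ⁻¹` injects the weak excedance values below `i` into the weak excedance positions below `i`.
If `τ i < i`, pigeonhole gives a position `b < i` with `τ b ≥ i`, which this injection misses. -/
theorem nonCrossing_excedance {n : ℕ} (τ : Equiv.Perm (Fin n)) :
    NonCrossing (excedancePositions τ) (excedanceValues τ) := by
  have hsub : ∀ i, ((excedanceValues τ).filter (· < i)).image (τ⁻¹ : Equiv.Perm (Fin n)) ⊆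
      (excedancePositions τ).filter (· < i) := by
    intro i x hx
    obtain ⟨b, hb, rfl⟩ := Finset.mem_image.1 hx
    simp only [excedanceValues, excedancePositions, Finset.mem_filter, Finset.mem_univ,
      true_and] at hb ⊢
    exact ⟨by simpa using hb.1, hb.1.trans_lt hb.2⟩
  refine ⟨?_, fun i => ⟨?_, fun hi => ?_⟩⟩
  · rw [← image_excedancePositions, Finset.card_image_of_injective _ τ.injective]
  · rw [← Finset.card_image_of_injective _ (τ⁻¹ : Equiv.Perm (Fin n)).injective]
    exact Finset.card_le_card (hsub i)
  · rw [← Finset.card_image_of_injective _ (τ⁻¹ : Equiv.Perm (Fin n)).injective]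
    simp only [excedancePositions, Finset.mem_filter, Finset.mem_univ, true_and, not_le] at hi
    obtain ⟨b, hb, hb'⟩ := exists_lt_le_apply τ (t := i) ⟨i, le_rfl, hi⟩
    refine Finset.card_lt_card ((Finset.ssubset_iff_of_subset (hsub i)).2 ⟨b, ?_, ?_⟩)
    · simp only [excedancePositions, Finset.mem_filter, Finset.mem_univ, true_and]
      omega
    · intro hx
      obtain ⟨c, hc, rfl⟩ := Finset.mem_image.1 hx
      rw [show τ (τ⁻¹ c) = c by simp] at hb'
      have := (Finset.mem_filter.1 hc).2
      omega

theorem Avoids321.eq_of_excedance_eq {n : ℕ} {τ τ' : Equiv.Perm (Fin n)} (h : Avoids321 τ)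
    (h' : Avoids321 τ') (hE : excedancePositions τ = excedancePositions τ')
    (hV : excedanceValues τ = excedanceValues τ') : τ = τ' := by
  have himg : (excedancePositions τ).image τ = (excedancePositions τ).image τ' := by
    rw [image_excedancePositions, hV, hE, image_excedancePositions]
  ext a : 1
  by_cases ha : a ∈ excedancePositions τ
  · refine eqOn_of_strictMonoOn_of_image_eq (h.strictMonoOn_excedance.mono ?_)
      (h'.strictMonoOn_excedance.mono ?_) himg ha
    · intro x hx
      simpa [excedancePositions] using hx
    · rw [hE]
      intro x hx
      simpa [excedancePositions] using hx
  · refine eqOn_of_strictMonoOn_of_image_eq (E := (excedancePositions τ)ᶜ)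
      (h.strictMonoOn_not_excedance.mono ?_)
      (h'.strictMonoOn_not_excedance.mono ?_) ?_ (by simpa using ha)
    · intro x hx
      simpa [excedancePositions] using hx
    · rw [hE]
      intro x hx
      simpa [excedancePositions] using hx
    · rw [image_compl_perm, image_compl_perm, himg]

theorem card_filter_add_card_compl_filter {n : ℕ} (E : Finset (Fin n)) (a : Fin n) :
    (E.filter (· < a)).card + (Eᶜ.filter (· < a)).card =
      (Finset.univ.filter (· < a)).card := by
  rw [← Finset.card_union_of_disjoint, ← Finset.filter_union, Finset.union_compl]
  exact Finset.disjoint_filter_filter disjoint_compl_right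

theorem exists_perm_strictMonoOn {n : ℕ} {E V : Finset (Fin n)} (h : E.card = V.card) :
    ∃ τ : Equiv.Perm (Fin n), StrictMonoOn τ E ∧ StrictMonoOn τ (Eᶜ : Finset (Fin n)) ∧
      E.image τ = V := by
  classical
  have h1 : Fintype.card {x // x ∈ E} = E.card := by simp
  have h2 : Fintype.card {x // x ∈ V} = E.card := by simp [h]
  have h3 : Fintype.card {x // ¬ x ∈ E} = n - E.card := by
    rw [Fintype.card_subtype_compl]; simp
  have h4 : Fintype.card {x // ¬ x ∈ V} = n - E.card := by
    rw [Fintype.card_subtype_compl]; simp [h]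
  let e := (Fintype.orderIsoFinOfCardEq _ h1).symm.trans (Fintype.orderIsoFinOfCardEq _ h2)
  let f := (Fintype.orderIsoFinOfCardEq _ h3).symm.trans (Fintype.orderIsoFinOfCardEq _ h4)
  let τ : Equiv.Perm (Fin n) := Equiv.subtypeCongr e.toEquiv f.toEquiv
  have hE : ∀ a (ha : a ∈ E), τ a = e ⟨a, ha⟩ := fun a ha => by
    simp [τ, Equiv.subtypeCongr, Equiv.sumCompl_symm_apply_of_pos (p := (· ∈ E)) ha]
  have hE' : ∀ a (ha : a ∉ E), τ a = f ⟨a, ha⟩ := fun a ha => by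
    simp [τ, Equiv.subtypeCongr, Equiv.sumCompl_symm_apply_of_neg (p := (· ∈ E)) ha]
  refine ⟨τ, fun a ha b hb hab => ?_, fun a ha b hb hab => ?_, ?_⟩
  · rw [hE a ha, hE b hb, Subtype.coe_lt_coe]
    exact e.strictMono hab
  · rw [hE' a (by simpa using ha), hE' b (by simpa using hb), Subtype.coe_lt_coe]
    exact f.strictMono hab
  · refine Finset.eq_of_subset_of_card_le (fun x hx => ?_) ?_
    · obtain ⟨a, ha, rfl⟩ := Finset.mem_image.1 hx
      rw [hE a ha]
      exact (e ⟨a, ha⟩).2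
    · rw [Finset.card_image_of_injective _ τ.injective, h]

/-- Take `τ` increasing from `E` to `V` and from `Eᶜ` to `Vᶜ`. Comparing ranks, the counting
conditions on prefixes force `a ≤ τ a` exactly on `E`. -/
theorem exists_avoids321_of_nonCrossing {n : ℕ} {E V : Finset (Fin n)} (h : NonCrossing E V) :
    ∃ τ : Equiv.Perm (Fin n), Avoids321 τ ∧ excedancePositions τ = E ∧
      excedanceValues τ = V := by
  obtain ⟨τ, hm, hm', hV⟩ := exists_perm_strictMonoOn h.1
  have hpos : ∀ a ∈ E, a ≤ τ a := by
    intro a ha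
    by_contra! hlt
    have h1 := card_image_filter_lt hm ha
    rw [hV] at h1
    have h2 := card_filter_lt_strictMono (V := V)
      (by rw [← hV]; exact Finset.mem_image_of_mem τ ha) hlt
    have h3 := (h.2 a).1
    omega
  have hneg : ∀ a ∉ E, τ a < a := by
    intro a ha
    by_contra! hle
    have h1 := card_image_filter_lt hm' (a := a) (by simpa using ha)
    rw [image_compl_perm, hV] at h1
    have h2 : (Vᶜ.filter (· < a)).card ≤ (Vᶜ.filter (· < τ a)).card :=
      Finset.card_le_card (Finset.monotone_filter_right _ fun x _ hx => lt_of_lt_of_le hx hle)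
    have h3 := (h.2 a).2 ha
    have h4 := card_filter_add_card_compl_filter E a
    have h5 := card_filter_add_card_compl_filter V a
    omega
  have hE : excedancePositions τ = E := by
    ext a
    simp only [excedancePositions, Finset.mem_filter, Finset.mem_univ, true_and]
    exact ⟨fun hle => by_contra fun ha => absurd (hneg a ha) (not_lt.2 hle), hpos a⟩
  refine ⟨τ, ?_, hE, by rw [← image_excedancePositions, hE, hV]⟩
  rintro i j k hij hjk ⟨h1, h2⟩
  -- A union of two increasing subsequences has no 321: its three entries would have to lie in
  -- pairwise different classes among two.
  have key : ∀ a b, a < b → τ b < τ a → ¬ (a ∈ E ↔ b ∈ E) := by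
    intro a b hab hba hiff
    by_cases ha : a ∈ E
    · exact absurd (hm ha (hiff.1 ha) hab) hba.not_gt
    · exact absurd (hm' (by simpa using ha) (by simpa using fun hb => ha (hiff.2 hb)) hab)
        hba.not_gt
  have := key i j hij h2
  have := key j k hjk h1
  have := key i k (hij.trans hjk) (h1.trans h2)
  tauto

/-! ### Path heights and interleaved words -/

/-- The height of the lattice path of `w` after `l` steps. -/
def pathHeight {m : ℕ} (w : Fin m → Fin 2) (l : ℕ) : ℤ :=
  ∑ p ∈ Finset.range l, if letterAt w p = 0 then 1 else -1

theorem card_prefix_eq_sum {m : ℕ} (w : Fin m → Fin 2) (a : Fin 2) {l : ℕ} (hl : l ≤ m) :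
    (Finset.univ.filter fun i : Fin m => i.val < l ∧ w i = a).card =
      ∑ p ∈ Finset.range l, if letterAt w p = a then 1 else 0 := by
  rw [← Finset.card_filter]
  refine Finset.card_bij (fun i _ => (i : ℕ)) (fun i hi => ?_) (fun i _ j _ h => Fin.ext h)
    (fun p hp => ?_)
  · simp only [Finset.mem_filter, Finset.mem_univ, true_and] at hi
    exact Finset.mem_filter.2 ⟨Finset.mem_range.2 hi.1, by simpa [letterAt] using hi.2⟩
  · simp only [Finset.mem_filter, Finset.mem_range] at hp
    have hpm : p < m := by omega
    exact ⟨⟨p, hpm⟩, by simpa [letterAt, hpm] using hp, rfl⟩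

theorem eq_zero_or_one (a : Fin 2) : a = 0 ∨ a = 1 := by
  revert a
  decide

theorem pathHeight_eq {m : ℕ} (w : Fin m → Fin 2) {l : ℕ} (hl : l ≤ m) :
    pathHeight w l = ((Finset.univ.filter fun i : Fin m => i.val < l ∧ w i = 0).card : ℤ) -
      (Finset.univ.filter fun i : Fin m => i.val < l ∧ w i = 1).card := by
  rw [card_prefix_eq_sum w 0 hl, card_prefix_eq_sum w 1 hl]
  push_cast
  rw [← Finset.sum_sub_distrib]
  refine Finset.sum_congr rfl fun p _ => ?_
  obtain h | h := eq_zero_or_one (letterAt w p) <;> simp [h]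

theorem isCatalanWord_iff_pathHeight {n : ℕ} (w : Fin (2 * n) → Fin 2) :
    IsCatalanWord w ↔ pathHeight w (2 * n) = 0 ∧ ∀ l ≤ 2 * n, 0 ≤ pathHeight w l := by
  have h := card_zero_add_card_one w
  refine and_congr ?_ (forall₂_congr fun l hl => ?_)
  · rw [pathHeight_eq w le_rfl]
    simp only [Fin.is_lt, true_and]
    omega
  · rw [pathHeight_eq w hl]
    omega

/-- The word with letter `0` at the even positions `2 * i`, `i ∈ E`, and letter `1` at the odd
positions `2 * i + 1`, `i ∈ V`. -/
def interleave {n : ℕ} (E V : Finset (Fin n)) : Fin (2 * n) → Fin 2 := fun p =>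
  if p.val % 2 = 0 then (if (⟨p / 2, by omega⟩ : Fin n) ∈ E then 0 else 1)
  else (if (⟨p / 2, by omega⟩ : Fin n) ∈ V then 1 else 0)

section interleave

variable {n : ℕ} (E V : Finset (Fin n))

theorem letterAt_interleave_even (i : Fin n) :
    letterAt (interleave E V) (2 * i) = if i ∈ E then 0 else 1 := by
  have h : 2 * (i : ℕ) < 2 * n := by omega
  simp [letterAt, interleave, h]

theorem letterAt_interleave_odd (i : Fin n) :
    letterAt (interleave E V) (2 * i + 1) = if i ∈ V then 1 else 0 := by
  have h : 2 * (i : ℕ) + 1 < 2 * n := by omega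
  have h' : (2 * (i : ℕ) + 1) / 2 = i := by omega
  simp [letterAt, interleave, h, h', Nat.add_mod]

variable {E V} in
theorem interleave_injective {E' V' : Finset (Fin n)} (h : interleave E V = interleave E' V') :
    E = E' ∧ V = V' := by
  constructor <;> ext i
  · have := letterAt_interleave_even E V i
    rw [h, letterAt_interleave_even] at this
    by_cases h1 : i ∈ E <;> by_cases h2 : i ∈ E' <;> simp_all
  · have := letterAt_interleave_odd E V i
    rw [h, letterAt_interleave_odd] at this
    by_cases h1 : i ∈ V <;> by_cases h2 : i ∈ V' <;> simp_all

theorem exists_eq_interleave (w : Fin (2 * n) → Fin 2) : ∃ E V, w = interleave E V := by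
  refine ⟨Finset.univ.filter fun i => w ⟨2 * i, by omega⟩ = 0,
    Finset.univ.filter fun i => w ⟨2 * i + 1, by omega⟩ = 1, ?_⟩
  funext p
  simp only [interleave, Finset.mem_filter, Finset.mem_univ, true_and]
  split_ifs with h0 h1 h1
  · rw [← h1]
    congr 1
    ext
    simp
    omega
  · rw [← (eq_zero_or_one _).resolve_left h1]
    congr 1
    ext
    simp
    omega
  · rw [← h1]
    congr 1
    ext
    simp
    omega
  · rw [← (eq_zero_or_one _).resolve_right h1]
    congr 1
    ext
    simp
    omega

theorem card_filter_val_succ {i : ℕ} (hi : i < n) :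
    (E.filter fun a : Fin n => a.val < i + 1).card =
      (E.filter fun a : Fin n => a.val < i).card + if (⟨i, hi⟩ : Fin n) ∈ E then 1 else 0 := by
  split_ifs with h
  · rw [← Finset.card_insert_of_notMem (a := ⟨i, hi⟩) (by simp)]
    congr 1
    ext a
    simp only [Finset.mem_filter, Finset.mem_insert, Fin.ext_iff]
    constructor
    · rintro ⟨h1, h2⟩
      by_cases h3 : a.val = i
      · exact Or.inl h3
      · exact Or.inr ⟨h1, by omega⟩
    · rintro (h1 | ⟨h1, h2⟩)
      · obtain rfl : a = ⟨i, hi⟩ := Fin.ext h1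
        exact ⟨h, by simp⟩
      · exact ⟨h1, by omega⟩
  · rw [add_zero]
    congr 1
    refine Finset.filter_congr fun a ha => ⟨fun h1 => ?_, fun h1 => by omega⟩
    have : a ≠ ⟨i, hi⟩ := fun e => h (e ▸ ha)
    rw [Ne, Fin.ext_iff] at this
    simp only at this
    omega

theorem pathHeight_interleave_even {i : ℕ} (hi : i ≤ n) :
    pathHeight (interleave E V) (2 * i) =
      2 * (((E.filter fun a : Fin n => a.val < i).card : ℤ) -
        (V.filter fun a : Fin n => a.val < i).card) := by
  induction i with
  | zero => simp [pathHeight]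
  | succ i ih =>
    have h1 := letterAt_interleave_even E V ⟨i, hi⟩
    have h2 := letterAt_interleave_odd E V ⟨i, hi⟩
    have ih := ih (by omega)
    rw [pathHeight] at ih ⊢
    simp only at h1 h2
    rw [mul_add, mul_one, Finset.sum_range_succ, Finset.sum_range_succ, ih, h1, h2,
      card_filter_val_succ E hi, card_filter_val_succ V hi]
    split_ifs <;> simp_all <;> ring

theorem pathHeight_interleave_odd (i : Fin n) :
    pathHeight (interleave E V) (2 * i + 1) =
      2 * (((E.filter (· < i)).card : ℤ) - (V.filter (· < i)).card) +
        if i ∈ E then 1 else -1 := by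
  have h := pathHeight_interleave_even E V i.2.le
  have h1 := letterAt_interleave_even E V i
  rw [pathHeight] at h ⊢
  rw [Finset.sum_range_succ, h, h1]
  congr 1
  split_ifs <;> simp_all

/-- The weak inequalities of `NonCrossing` are nonnegativity at even times; the strict ones, for `i
∉ E`, are nonnegativity after the down step at position `2 * i`. -/
theorem isCatalanWord_interleave_iff : IsCatalanWord (interleave E V) ↔ NonCrossing E V := by
  have hfull := pathHeight_interleave_even E V le_rfl
  simp only [Fin.is_lt, Finset.filter_true] at hfull
  rw [isCatalanWord_iff_pathHeight, NonCrossing, hfull]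
  refine ⟨fun ⟨h0, H⟩ => ⟨by omega, fun i => ⟨?_, fun hi => ?_⟩⟩,
    fun ⟨h0, H⟩ => ⟨by omega, fun l hl => ?_⟩⟩
  · have h := H (2 * i) (by omega)
    rw [pathHeight_interleave_even E V i.2.le] at h
    simp only [Fin.val_fin_lt] at h
    omega
  · have h := H (2 * i + 1) (by omega)
    rw [pathHeight_interleave_odd, if_neg hi] at h
    omega
  · obtain ⟨i, rfl | rfl⟩ : ∃ i, l = 2 * i ∨ l = 2 * i + 1 := ⟨l / 2, by omega⟩
    · obtain rfl | hi : i = n ∨ i < n := by omega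
      · rw [hfull]
        omega
      · rw [pathHeight_interleave_even E V hi.le]
        have h := (H ⟨i, hi⟩).1
        simp only [Fin.lt_def] at h
        omega
    · have h := H ⟨i, by omega⟩
      rw [pathHeight_interleave_odd E V ⟨i, by omega⟩]
      split_ifs with hi
      · omega
      · have := h.2 hi
        omega

end interleave

/-! ### Major index of words through descents and peaks -/

/-- The sequence `x` has a descent between the positions `i` and `i + 1` (counted from `0`). -/
def HasDescentAt {α : Type*} [LinearOrder α] {m : ℕ} (x : Fin m → α) (i : ℕ) : Prop :=
  ∃ h : i + 1 < m, x ⟨i + 1, h⟩ < x ⟨i, by omega⟩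

open Classical in
theorem sum_descentSet {α : Type*} [LinearOrder α] {m : ℕ} (x : Fin m → α) (f : ℕ → ℤ) :
    ∑ i ∈ descentSet x, f i =
      ∑ i ∈ Finset.range (m - 1), if HasDescentAt x i then f (i + 1) else 0 := by
  rw [← Finset.sum_filter]
  symm
  refine Finset.sum_bij (fun i _ => i + 1) (fun i hi => ?_) (fun i _ j _ h => by simpa using h)
    (fun j hj => ?_) (fun _ _ => rfl)
  · simp only [Finset.mem_filter, Finset.mem_range] at hi
    obtain ⟨hi, h, hx⟩ := hi
    exact Finset.mem_filter.2 ⟨Finset.mem_range.2 h, by simp; omega, h, by omega, by simpa using hx⟩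
  · obtain ⟨hj, h1, h2, h3, hx⟩ := Finset.mem_filter.1 hj
    obtain _ | j := j
    · omega
    · exact ⟨j, Finset.mem_filter.2 ⟨Finset.mem_range.2 (by omega), h2, by simpa using hx⟩, rfl⟩

open Classical in
theorem majorIndex_eq {α : Type*} [LinearOrder α] {m : ℕ} (x : Fin m → α) :
    (majorIndex x : ℤ) =
      ∑ i ∈ Finset.range (m - 1), if HasDescentAt x i then ((i : ℤ) + 1) else 0 := by
  have := sum_descentSet x fun i => (i : ℤ)
  push_cast at this
  rw [majorIndex, ← this]
  push_cast
  rfl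

open Classical in
theorem descentNumber_eq {α : Type*} [LinearOrder α] {m : ℕ} (x : Fin m → α) :
    (descentNumber x : ℤ) =
      ∑ i ∈ Finset.range (m - 1), if HasDescentAt x i then (1 : ℤ) else 0 := by
  rw [descentNumber, ← sum_descentSet x fun _ => 1]
  simp

theorem hasDescentAt_wordInverse {m : ℕ} (w : Fin m → Fin 2) {i : ℕ} (hi : i < m - 1) :
    HasDescentAt (wordInverse w) i ↔ HasDescentAt w (m - 1 - 1 - i) := by
  have h1 : i + 1 < m := by omega
  have h2 : m - 1 - 1 - i + 1 < m := by omega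
  have e1 : (⟨i + 1, h1⟩ : Fin m).rev = ⟨m - 1 - 1 - i, by omega⟩ := by
    ext; simp [Fin.val_rev]; omega
  have e2 : (⟨i, by omega⟩ : Fin m).rev = ⟨m - 1 - 1 - i + 1, h2⟩ := by
    ext; simp [Fin.val_rev]; omega
  have key : ∀ a b : Fin 2, 1 - a < 1 - b ↔ b < a := by decide
  simp only [HasDescentAt, h1, h2, exists_true_left, wordInverse, e1, e2, key]

theorem majorIndex_wordInverse {m : ℕ} (w : Fin m → Fin 2) :
    (majorIndex (wordInverse w) : ℤ) = m * descentNumber w - majorIndex w := by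
  classical
  rw [majorIndex_eq, descentNumber_eq, majorIndex_eq, Finset.mul_sum, ← Finset.sum_sub_distrib,
    ← Finset.sum_range_reflect]
  refine Finset.sum_congr rfl fun i hi => ?_
  have hi := Finset.mem_range.1 hi
  have h : m - 1 - 1 - (m - 1 - 1 - i) = i := by omega
  simp only [hasDescentAt_wordInverse w (i := m - 1 - 1 - i) (by omega), h]
  split_ifs
  · omega
  · simp

/-- The word `w` has a peak at the positions `p`, `p + 1` (counted from `0`). -/
def HasPeakAt {m : ℕ} (w : Fin m → Fin 2) (p : ℕ) : Prop :=
  letterAt w p = 0 ∧ letterAt w (p + 1) = 1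

open Classical in
theorem peak_sub_descent {m : ℕ} (w : Fin m → Fin 2) {p : ℕ} (hp : p + 1 < m) (a : ℤ) :
    (if HasPeakAt w p then a else 0) - (if HasDescentAt w p then a else 0) =
      a * ((letterAt w (p + 1)).val - (letterAt w p).val) := by
  have h : HasDescentAt w p ↔ letterAt w (p + 1) = 0 ∧ letterAt w p = 1 := by
    have key : ∀ a b : Fin 2, a < b ↔ a = 0 ∧ b = 1 := by decide
    have hp' : p < m := by omega
    simp [HasDescentAt, hp, hp', letterAt, key]
  rw [HasPeakAt, h]
  obtain h1 | h1 := eq_zero_or_one (letterAt w p) <;>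
    obtain h2 | h2 := eq_zero_or_one (letterAt w (p + 1)) <;> simp [h1, h2]

/-- Summation by parts, for the weighted difference of peaks and descents. -/
theorem sum_range_succ_mul_sub (x : ℕ → ℤ) (M : ℕ) :
    ∑ p ∈ Finset.range M, ((p : ℤ) + 1) * (x (p + 1) - x p) =
      (M + 1) * x M - ∑ p ∈ Finset.range (M + 1), x p := by
  induction M with
  | zero => simp
  | succ M ih =>
    rw [Finset.sum_range_succ, ih, Finset.sum_range_succ _ (M + 1)]
    push_cast
    ring

open Classical in
/-- For Catalan words, peaks and valleys give the same value of the statistic. -/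
theorem majorIndex_sub_eq_sum_peaks {n : ℕ} {w : Fin (2 * n) → Fin 2} (hw : IsCatalanWord w) :
    (majorIndex w : ℤ) - n * descentNumber w =
      ∑ p ∈ Finset.range (2 * n - 1), if HasPeakAt w p then ((p : ℤ) + 1 - n) else 0 := by
  obtain _ | k := n
  · simp [majorIndex_eq, descentNumber_eq]
  obtain ⟨hend, hpos⟩ := (isCatalanWord_iff_pathHeight w).1 hw
  have hfirst : letterAt w 0 = 0 := by
    have := hpos 1 (by omega)
    refine (eq_zero_or_one _).resolve_right fun h => ?_
    simp [pathHeight, h] at this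
  have hlast : letterAt w (2 * k + 1) = 1 := by
    have h1 := hpos (2 * k + 1) (by omega)
    refine (eq_zero_or_one _).resolve_left fun h => ?_
    have hend : pathHeight w (2 * k + 1 + 1) = 0 := hend
    rw [pathHeight, Finset.sum_range_succ, h] at hend
    rw [pathHeight] at h1
    simp only [if_true] at hend
    omega
  have hsum : ∑ p ∈ Finset.range (2 * k + 1 + 1), ((letterAt w p).val : ℤ) = k + 1 := by
    have h1 := hw.1
    have h2 := card_prefix_eq_sum w 1 (l := 2 * (k + 1)) le_rfl
    simp only [Fin.is_lt, true_and] at h2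
    rw [h1] at h2
    have h3 := congrArg (Nat.cast : ℕ → ℤ) h2
    push_cast at h3
    rw [h3]
    refine Finset.sum_congr rfl fun p _ => ?_
    obtain h | h := eq_zero_or_one (letterAt w p) <;> simp [h]
  have hM : 2 * (k + 1) - 1 = 2 * k + 1 := by omega
  -- The difference telescopes to `2n - n - n = 0`, from last letter `1`, first letter `0` and
  -- exactly `n` letters `1`.
  have key : ∑ p ∈ Finset.range (2 * k + 1),
      ((if HasPeakAt w p then ((p : ℤ) + 1 - (k + 1 : ℕ)) else 0) -
        (if HasDescentAt w p then ((p : ℤ) + 1 - (k + 1 : ℕ)) else 0)) = 0 := by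
    rw [Finset.sum_congr rfl fun p hp => peak_sub_descent w
      (by have := Finset.mem_range.1 hp; omega) _]
    simp only [sub_mul]
    rw [Finset.sum_sub_distrib, ← Finset.mul_sum,
      sum_range_succ_mul_sub (fun p => ((letterAt w p).val : ℤ)), hsum,
      Finset.sum_range_sub (fun p => ((letterAt w p).val : ℤ)), hlast, hfirst]
    push_cast
    simp
    ring
  rw [Finset.sum_sub_distrib, sub_eq_zero] at key
  rw [majorIndex_eq, descentNumber_eq, hM, key, Finset.mul_sum, ← Finset.sum_sub_distrib]
  refine Finset.sum_congr rfl fun p _ => ?_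
  split_ifs <;> simp

open Classical in
theorem majorIndex_sub_eq_sum_halves {n : ℕ} {w : Fin (2 * n) → Fin 2} (hw : IsCatalanWord w) :
    (majorIndex w : ℤ) - n * descentNumber w =
      (∑ i ∈ Finset.range (n - 1), if HasPeakAt w i then ((i : ℤ) + 1 - n) else 0) +
      ∑ j ∈ Finset.range (n - 1), if HasPeakAt w (n + j) then ((j : ℤ) + 1) else 0 := by
  rw [majorIndex_sub_eq_sum_peaks hw]
  obtain _ | k := n
  · simp
  -- The middle peak, at `p = k = n - 1`, has weight `0` and drops out, leaving two ranges of length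
  -- `n - 1`.
  rw [show 2 * (k + 1) - 1 = k + 1 + k by omega, Nat.add_sub_cancel, Finset.sum_range_add,
    Finset.sum_range_succ]
  congr 1
  · simp
  · refine Finset.sum_congr rfl fun j _ => ?_
    split_ifs
    · push_cast
      ring
    · rfl

/-! ### Reversal, and descents read off the interleaved word -/

/-- Reversing the one-line notation turns `123` into `321`. -/
theorem avoids123_iff {n : ℕ} (σ : Equiv.Perm (Fin n)) :
    Avoids123 σ ↔ Avoids321 (σ * Fin.revPerm) := by
  refine ⟨fun h i j k hij hjk hh => h k.rev j.rev i.rev ?_ ?_ hh, fun h i j k hij hjk hh =>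
    h k.rev j.rev i.rev ?_ ?_ (by simpa using hh)⟩ <;> simpa

theorem hasDescentAt_mul_revPerm {n : ℕ} (σ : Equiv.Perm (Fin n)) {i : ℕ} (hi : i < n - 1) :
    HasDescentAt σ i ↔ ¬ HasDescentAt (σ * Fin.revPerm : Equiv.Perm (Fin n)) (n - 1 - 1 - i) := by
  have h1 : i + 1 < n := by omega
  have h2 : n - 1 - 1 - i + 1 < n := by omega
  have e1 : (⟨n - 1 - 1 - i, by omega⟩ : Fin n).rev = ⟨i + 1, h1⟩ := by
    ext; simp [Fin.val_rev]; omega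
  have e2 : (⟨n - 1 - 1 - i + 1, h2⟩ : Fin n).rev = ⟨i, by omega⟩ := by
    ext; simp [Fin.val_rev]; omega
  have hne : σ ⟨i + 1, h1⟩ ≠ σ ⟨i, by omega⟩ := fun e => by simpa using σ.injective e
  simp only [HasDescentAt, h1, h2, exists_true_left, Equiv.Perm.mul_apply, Fin.revPerm_apply, e1,
    e2, not_lt]
  exact ⟨le_of_lt, fun h => lt_of_le_of_ne h hne⟩

theorem hasDescentAt_revPerm_mul {n : ℕ} (σ : Equiv.Perm (Fin n)) {i : ℕ} (hi : i < n - 1) :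
    HasDescentAt σ i ↔ ¬ HasDescentAt (Fin.revPerm * σ : Equiv.Perm (Fin n)) i := by
  have h1 : i + 1 < n := by omega
  have hne : σ ⟨i + 1, h1⟩ ≠ σ ⟨i, by omega⟩ := fun e => by simpa using σ.injective e
  simp only [HasDescentAt, h1, exists_true_left, Equiv.Perm.mul_apply, Fin.revPerm_apply, not_lt,
    Fin.rev_le_rev]
  exact ⟨le_of_lt, fun h => lt_of_le_of_ne h hne⟩

-- Reversal exchanges descents and ascents, so each major index is a constant minus a sum over
-- descents of `τ` or `τ⁻¹`. The two constants are equal by reflection and cancel.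
open Classical in
theorem majorIndex_sub_majorIndex_inv {n : ℕ} (σ : Equiv.Perm (Fin n)) :
    (majorIndex (σ : Fin n → Fin n) : ℤ) - majorIndex (σ⁻¹ : Equiv.Perm (Fin n)) =
      (∑ i ∈ Finset.range (n - 1),
        if HasDescentAt (σ * Fin.revPerm : Equiv.Perm (Fin n)) i then ((i : ℤ) + 1 - n) else 0) +
      ∑ j ∈ Finset.range (n - 1),
        if HasDescentAt ((σ * Fin.revPerm)⁻¹ : Equiv.Perm (Fin n)) j then ((j : ℤ) + 1) else 0 := by
  have hinv : (σ * Fin.revPerm)⁻¹ = Fin.revPerm * σ⁻¹ := by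
    rw [mul_inv_rev]
    rfl
  have hconst : ∑ i ∈ Finset.range (n - 1), (((n : ℤ) - 1 - i) - (i + 1)) = 0 := by
    rw [Finset.sum_sub_distrib, sub_eq_zero, ← Finset.sum_range_reflect]
    refine Finset.sum_congr rfl fun i hi => ?_
    have := Finset.mem_range.1 hi
    omega
  rw [majorIndex_eq, majorIndex_eq, hinv, ← Finset.sum_range_reflect, ← Finset.sum_sub_distrib,
    ← Finset.sum_add_distrib, ← sub_eq_zero, ← Finset.sum_sub_distrib, ← hconst]
  refine Finset.sum_congr rfl fun i hi => ?_
  have hi := Finset.mem_range.1 hi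
  have h : n - 1 - 1 - (n - 1 - 1 - i) = i := by omega
  simp only [hasDescentAt_mul_revPerm σ (i := n - 1 - 1 - i) (by omega), h,
    hasDescentAt_revPerm_mul σ⁻¹ hi]
  split_ifs <;> first | contradiction | omega

/-- The Catalan word that interleaves the weak excedance positions and values of the reverse of
`σ`. -/
def excedanceWord {n : ℕ} (σ : Equiv.Perm (Fin n)) : Fin (2 * n) → Fin 2 :=
  interleave (excedancePositions (σ * Fin.revPerm)) (excedanceValues (σ * Fin.revPerm))

theorem hasDescentAt_iff_even {n : ℕ} {τ : Equiv.Perm (Fin n)} (h : Avoids321 τ) {i : ℕ}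
    (hi : i < n - 1) : HasDescentAt τ i ↔
      letterAt (interleave (excedancePositions τ) (excedanceValues τ)) (2 * i) = 0 ∧
      letterAt (interleave (excedancePositions τ) (excedanceValues τ)) (2 * i + 2) = 1 := by
  have h1 : i + 1 < n := by omega
  have e0 := letterAt_interleave_even (excedancePositions τ) (excedanceValues τ) ⟨i, by omega⟩
  have e1 := letterAt_interleave_even (excedancePositions τ) (excedanceValues τ) ⟨i + 1, h1⟩
  have hd := h.descent_iff (i := ⟨i, by omega⟩) (j := ⟨i + 1, h1⟩) rfl
  rw [show 2 * i + 2 = 2 * (i + 1) by ring]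
  simp only at e0 e1
  rw [e0, e1]
  simp only [HasDescentAt, h1, exists_true_left, hd, excedancePositions, Finset.mem_filter,
    Finset.mem_univ, true_and]
  refine and_congr ?_ ?_
  · split_ifs <;> simp_all
  · split_ifs <;> simp_all

theorem hasDescentAt_inv_iff_odd {n : ℕ} {τ : Equiv.Perm (Fin n)} (h : Avoids321 τ) {i : ℕ}
    (hi : i < n - 1) : HasDescentAt (τ⁻¹ : Equiv.Perm (Fin n)) i ↔
      letterAt (interleave (excedancePositions τ) (excedanceValues τ)) (2 * i + 1) = 0 ∧
      letterAt (interleave (excedancePositions τ) (excedanceValues τ)) (2 * i + 1 + 2) = 1 := by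
  have h1 : i + 1 < n := by omega
  have e0 := letterAt_interleave_odd (excedancePositions τ) (excedanceValues τ) ⟨i, by omega⟩
  have e1 := letterAt_interleave_odd (excedancePositions τ) (excedanceValues τ) ⟨i + 1, h1⟩
  have hd := h.inv.descent_iff' (i := ⟨i, by omega⟩) (j := ⟨i + 1, h1⟩) rfl
  rw [show 2 * i + 1 + 2 = 2 * (i + 1) + 1 by ring]
  simp only at e0 e1
  rw [e0, e1]
  simp only [HasDescentAt, h1, exists_true_left, hd, excedanceValues, Finset.mem_filter,
    Finset.mem_univ, true_and]
  refine and_congr ?_ ?_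
  · split_ifs <;> simp_all
  · split_ifs <;> simp_all

open Classical in
theorem card_avoiding123_descents (n : ℕ) (A B : Finset ℕ) (hA : A ⊆ Finset.range (n - 1))
    (hB : B ⊆ Finset.range (n - 1)) :
    ((avoiding123 n).filter fun σ =>
      (∀ i ∈ A, HasDescentAt (σ * Fin.revPerm : Equiv.Perm (Fin n)) i) ∧
        ∀ j ∈ B, HasDescentAt ((σ * Fin.revPerm)⁻¹ : Equiv.Perm (Fin n)) j).card =
    ((catalanWords n).filter fun w =>
      (∀ i ∈ A, letterAt w (2 * i) = 0 ∧ letterAt w (2 * i + 2) = 1) ∧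
        ∀ j ∈ B, letterAt w (2 * j + 1) = 0 ∧ letterAt w (2 * j + 1 + 2) = 1).card := by
  have key : ∀ σ : Equiv.Perm (Fin n), Avoids123 σ →
      (((∀ i ∈ A, HasDescentAt (σ * Fin.revPerm : Equiv.Perm (Fin n)) i) ∧
        ∀ j ∈ B, HasDescentAt ((σ * Fin.revPerm)⁻¹ : Equiv.Perm (Fin n)) j) ↔
      ((∀ i ∈ A, letterAt (excedanceWord σ) (2 * i) = 0 ∧
          letterAt (excedanceWord σ) (2 * i + 2) = 1) ∧
        ∀ j ∈ B, letterAt (excedanceWord σ) (2 * j + 1) = 0 ∧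
          letterAt (excedanceWord σ) (2 * j + 1 + 2) = 1)) := fun σ hσ =>
    and_congr
      (forall₂_congr fun i hi =>
        hasDescentAt_iff_even ((avoids123_iff σ).1 hσ) (Finset.mem_range.1 (hA hi)))
      (forall₂_congr fun i hi =>
        hasDescentAt_inv_iff_odd ((avoids123_iff σ).1 hσ) (Finset.mem_range.1 (hB hi)))
  refine Finset.card_bij (fun σ _ => excedanceWord σ) (fun σ hσ => ?_) (fun σ hσ σ' hσ' he => ?_)
    (fun w hw => ?_)
  · obtain ⟨h1, h2⟩ := Finset.mem_filter.1 hσ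
    have h1 := (Finset.mem_filter.1 h1).2
    exact Finset.mem_filter.2 ⟨Finset.mem_filter.2 ⟨Finset.mem_univ _,
      (isCatalanWord_interleave_iff _ _).2 (nonCrossing_excedance _)⟩, (key σ h1).1 h2⟩
  · have h1 := (Finset.mem_filter.1 (Finset.mem_filter.1 hσ).1).2
    have h2 := (Finset.mem_filter.1 (Finset.mem_filter.1 hσ').1).2
    obtain ⟨hE, hV⟩ := interleave_injective he
    exact mul_right_cancel
      (((avoids123_iff σ).1 h1).eq_of_excedance_eq ((avoids123_iff σ').1 h2) hE hV)
  · obtain ⟨h1, h2⟩ := Finset.mem_filter.1 hw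
    obtain ⟨E, V, rfl⟩ := exists_eq_interleave w
    obtain ⟨τ, hτ, rfl, rfl⟩ := exists_avoids321_of_nonCrossing
      ((isCatalanWord_interleave_iff E V).1 (Finset.mem_filter.1 h1).2)
    have hτ' : τ * (Fin.revPerm : Equiv.Perm (Fin n))⁻¹ * Fin.revPerm = τ := by simp
    have hσ : Avoids123 (τ * (Fin.revPerm : Equiv.Perm (Fin n))⁻¹) := by
      rw [avoids123_iff, hτ']
      exact hτ
    have hw' : excedanceWord (τ * (Fin.revPerm : Equiv.Perm (Fin n))⁻¹) =
        interleave (excedancePositions τ) (excedanceValues τ) := by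
      rw [excedanceWord, hτ']
    refine ⟨_, Finset.mem_filter.2 ⟨Finset.mem_filter.2 ⟨Finset.mem_univ _, hσ⟩, ?_⟩, hw'⟩
    rw [key _ hσ, hw']
    exact h2

/-! ### Generating functions -/

open LaurentPolynomial in
theorem T_sum {ι : Type*} (s : Finset ι) (f : ι → ℤ) :
    (T (∑ i ∈ s, f i) : LaurentPolynomial ℤ) = ∏ i ∈ s, T (f i) := by
  classical
  induction s using Finset.induction_on with
  | empty => simp
  | insert a s ha ih => rw [Finset.sum_insert ha, Finset.prod_insert ha, T_add, ih]

open Classical LaurentPolynomial in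
/-- Expansion of the generating function of a statistic that is additive over the elements of two
random sets, in terms of the numbers of objects whose two sets contain given sets. -/
theorem sum_T_eq_sum_powerset {ι : Type*} (Ω : Finset ι) (N : ℕ) (P Q : ℕ → ι → Prop)
    (e f : ℕ → ℤ) :
    ∑ x ∈ Ω, (T ((∑ i ∈ Finset.range N, if P i x then e i else 0) +
        ∑ j ∈ Finset.range N, if Q j x then f j else 0) : LaurentPolynomial ℤ) =
      ∑ A ∈ (Finset.range N).powerset, ∑ B ∈ (Finset.range N).powerset,
        ((Ω.filter fun x => (∀ i ∈ A, P i x) ∧ ∀ j ∈ B, Q j x).card : LaurentPolynomial ℤ) *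
          ((∏ i ∈ A, (T (e i) - 1)) * ∏ j ∈ B, (T (f j) - 1)) := by
  have hprod : ∀ (R : ℕ → ι → Prop) (g : ℕ → ℤ) (x : ι),
      (T (∑ i ∈ Finset.range N, if R i x then g i else 0) : LaurentPolynomial ℤ) =
        ∑ A ∈ (Finset.range N).powerset, if ∀ i ∈ A, R i x then ∏ i ∈ A, (T (g i) - 1) else 0 := by
    intro R g x
    have : ∀ i, (T (if R i x then g i else 0) : LaurentPolynomial ℤ) =
        1 + if R i x then T (g i) - 1 else 0 := fun i => by split_ifs <;> simp
    rw [T_sum, Finset.prod_congr rfl fun i _ => this i, Finset.prod_one_add]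
    exact Finset.sum_congr rfl fun A _ => Finset.prod_ite_zero
  simp only [T_add, hprod, Finset.sum_mul_sum]
  rw [Finset.sum_comm]
  refine Finset.sum_congr rfl fun A _ => ?_
  rw [Finset.sum_comm]
  refine Finset.sum_congr rfl fun B _ => ?_
  rw [Finset.card_filter, Nat.cast_sum, Finset.sum_mul]
  refine Finset.sum_congr rfl fun x _ => ?_
  have hmul : ∀ (p q : Prop) (a b : LaurentPolynomial ℤ),
      (if p then a else 0) * (if q then b else 0) = ((if p ∧ q then 1 else 0 : ℕ) : ℤ[T;T⁻¹]) *
        (a * b) := fun p q a b => by by_cases hp : p <;> by_cases hq : q <;> simp [hp, hq]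
  convert hmul _ _ _ _

-- The factor `c` rescales all weights at once, so one argument serves both identities, with `c = 2`
-- and `c = 1`.
open LaurentPolynomial in
theorem sum_T_catalanWords_eq (n : ℕ) (c : ℤ) :
    ∑ w ∈ catalanWords n,
        (T (c * ((majorIndex w : ℤ) - n * descentNumber w)) : LaurentPolynomial ℤ) =
      ∑ σ ∈ avoiding123 n, T (c * ((majorIndex (σ : Fin n → Fin n) : ℤ) -
        majorIndex (σ⁻¹ : Equiv.Perm (Fin n)))) := by
  classical
  have hw : ∀ w ∈ catalanWords n, (T (c * ((majorIndex w : ℤ) - n * descentNumber w)) :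
      LaurentPolynomial ℤ) =
      T ((∑ i ∈ Finset.range (n - 1), if HasPeakAt w i then c * ((i : ℤ) + 1 - n) else 0) +
        ∑ j ∈ Finset.range (n - 1), if HasPeakAt w (n + j) then c * ((j : ℤ) + 1) else 0) := by
    intro w hw
    rw [majorIndex_sub_eq_sum_halves (Finset.mem_filter.1 hw).2, mul_add, Finset.mul_sum,
      Finset.mul_sum]
    simp only [mul_ite, mul_zero]
  rw [Finset.sum_congr rfl hw]
  simp only [majorIndex_sub_majorIndex_inv, mul_add c, Finset.mul_sum, mul_ite, mul_zero]
  rw [sum_T_eq_sum_powerset _ _ (fun i w => HasPeakAt w i) (fun j w => HasPeakAt w (n + j)),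
    sum_T_eq_sum_powerset _ _
      (fun i (σ : Equiv.Perm (Fin n)) => HasDescentAt (σ * Fin.revPerm : Equiv.Perm (Fin n)) i)
      (fun j (σ : Equiv.Perm (Fin n)) =>
        HasDescentAt ((σ * Fin.revPerm)⁻¹ : Equiv.Perm (Fin n)) j)]
  refine Finset.sum_congr rfl fun A hA => Finset.sum_congr rfl fun B hB => ?_
  rw [Finset.mem_powerset] at hA hB
  rw [card_avoiding123_descents n A B hA hB, ← card_catalanWords_peaks n A B hA hB]
  congr!

theorem theorem1 (n : ℕ) :
    (∑ w ∈ catalanWords n,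
        (LaurentPolynomial.T ((majorIndex w : ℤ) - (majorIndex (wordInverse w) : ℤ)) :
          LaurentPolynomial ℤ)
      = ∑ σ ∈ avoiding123 n,
        (LaurentPolynomial.T
          (2 * ((majorIndex (σ : Fin n → Fin n) : ℤ) -
            (majorIndex (σ⁻¹ : Equiv.Perm (Fin n)) : ℤ))) : LaurentPolynomial ℤ)) ∧
    (∑ w ∈ catalanWords n,
        (LaurentPolynomial.T ((majorIndex w : ℤ) - (n : ℤ) * (descentNumber w : ℤ)) :
          LaurentPolynomial ℤ)
      = ∑ σ ∈ avoiding123 n,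
        (LaurentPolynomial.T
          ((majorIndex (σ : Fin n → Fin n) : ℤ) -
            (majorIndex (σ⁻¹ : Equiv.Perm (Fin n)) : ℤ)) : LaurentPolynomial ℤ)) := by
  refine ⟨?_, ?_⟩
  · rw [← sum_T_catalanWords_eq]
    refine Finset.sum_congr rfl fun w _ => ?_
    rw [majorIndex_wordInverse]
    congr 1
    push_cast
    ring
  · simpa using sum_T_catalanWords_eq n 1
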